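/- Sentences of continuous logic for C*-algebras are built as follows. Atomic formulas are norms $\|p(x_1,\dots,x_n)\|$ of complex $*$-polynomials without constant term in noncommuting variables; formulas are combined finitely many at a time by continuous functions $\mathbb{R}^k\to\mathbb{R}$, and are quantified by $\sup_{\|x\|\le 1}$ and $\inf_{\|x\|\le 1}$; a sentence is a formula without free variables. A sentence $\varphi$ has a real value $\varphi^{\mathcal A}$ in every (not necessarily unital) C*-algebra $\mathcal A$. A C*-algebra $\mathcal A$ is called pseudocompact if $\varphi^{\mathcal A}=0$ for every sentence $\varphi$ with $\varphi^{\mathcal F}=0$ for all finite-dimensional C*-algebras $\mathcal F$, and pseudomatricial if $\varphi^{\mathcal A}=0$ for every sentence $\varphi$ with $\varphi^{M_n(\mathbb{C})}=0$ for all $n\ge 1$. Proposition 6.1. Let $\mathcal A$ be a nonzero pseudocompact C*-algebra. Then $\mathcal A$ has an identity element $I$, and $\mathcal A$ is pseudomatricial if and only if its center is $Z(\mathcal A)=\mathbb{C}I$. -/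

import Mathlib

/-! Continuous first-order logic for C*-algebras, without a symbol for the identity, so that it
applies to C*-algebras that are not assumed unital (`NonUnitalCStarAlgebra`). -/

/-- Terms of the language of C*-algebras in the variables `x₀, …, xₙ₋₁`: the *-polynomials
(without constant term) in these variables. -/
inductive CStarTerm (n : ℕ) : Type
  | var (i : Fin n) : CStarTerm n
  | zero : CStarTerm n
  | add (s t : CStarTerm n) : CStarTerm n
  | mul (s t : CStarTerm n) : CStarTerm n
  | smul (c : ℂ) (t : CStarTerm n) : CStarTerm n
  | adjoint (t : CStarTerm n) : CStarTerm n

/-- Formulas of the language of C*-algebras whose free variables are among `x₀, …, xₙ₋₁`.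
Atomic formulas are norms of terms, connectives are continuous functions `ℝᵏ → ℝ`, and the
quantifiers are the supremum and the infimum over the closed unit ball, which bind the last
variable. -/
inductive CStarFormula : ℕ → Type
  | atom {n : ℕ} (t : CStarTerm n) : CStarFormula n
  | conn {n k : ℕ} (u : C(Fin k → ℝ, ℝ)) (φ : Fin k → CStarFormula n) : CStarFormula n
  | sup {n : ℕ} (φ : CStarFormula (n + 1)) : CStarFormula n
  | inf {n : ℕ} (φ : CStarFormula (n + 1)) : CStarFormula n

/-- A sentence is a formula without free variables. -/
abbrev CStarSentence : Type := CStarFormula 0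

/-- The value of a term in a C*-algebra `A`. -/
def CStarTerm.eval {A : Type*} [NonUnitalCStarAlgebra A] {n : ℕ} (v : Fin n → A) :
    CStarTerm n → A
  | .var i => v i
  | .zero => 0
  | .add s t => s.eval v + t.eval v
  | .mul s t => s.eval v * t.eval v
  | .smul c t => c • t.eval v
  | .adjoint t => star (t.eval v)

/-- The value of a formula in a C*-algebra `A`. The values of a formula are bounded as its
variables run through bounded sets, so the suprema and infima below are genuine ones, over a
non-empty index set. -/
noncomputable def CStarFormula.eval {A : Type*} [NonUnitalCStarAlgebra A] :
    {n : ℕ} → CStarFormula n → (Fin n → A) → ℝ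
  | _, .atom t, v => ‖t.eval v‖
  | _, .conn u φ, v => u fun i => (φ i).eval v
  | _, .sup φ, v => ⨆ x : Metric.closedBall (0 : A) 1, φ.eval (Fin.snoc v (x : A))
  | _, .inf φ, v => ⨅ x : Metric.closedBall (0 : A) 1, φ.eval (Fin.snoc v (x : A))

/-- The value `φ^A` of a sentence `φ` in a C*-algebra `A`. -/
noncomputable def CStarSentence.value (φ : CStarSentence) (A : Type*)
    [NonUnitalCStarAlgebra A] : ℝ :=
  CStarFormula.eval (A := A) φ Fin.elim0

/-- A C*-algebra `A` is pseudocompact if every sentence that is zero in all finite-dimensional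
C*-algebras is zero in `A`. (A finite-dimensional C*-algebra in any universe is *-isomorphic to
one in `Type`, so nothing is lost by letting `F` range over `Type`.) -/
def IsPseudocompact (A : Type*) [NonUnitalCStarAlgebra A] : Prop :=
  ∀ φ : CStarSentence,
    (∀ (F : Type) [NonUnitalCStarAlgebra F] [FiniteDimensional ℂ F], φ.value F = 0) →
      φ.value A = 0

section
open scoped Matrix.Norms.L2Operator

/-- A C*-algebra `A` is pseudomatricial if every sentence that is zero in all matrix algebras
`M_n(ℂ)`, `n ≥ 1`, is zero in `A`. The matrix algebras carry the conjugate transpose and the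
operator norm on the Hilbert space `ℂⁿ`. -/
def IsPseudomatricial (A : Type*) [NonUnitalCStarAlgebra A] : Prop :=
  ∀ φ : CStarSentence,
    (∀ n : ℕ, 0 < n → φ.value (Matrix (Fin n) (Fin n) ℂ) = 0) → φ.value A = 0

end

/-! Finitely many sentences transfer the finite-dimensional situation to `A`. Finite-dimensional
algebras have identities, so `identityDefect` vanishes in `A`, and completeness turns approximate
identities into an exact one.

If `A` is pseudomatricial: in `M_n` every `z` is within `derivationNorm z` of a scalar, so `‖z‖ *
‖x‖ ≤ ‖z * x‖ + 2 * derivationNorm z` for `x` in the unit ball. This inequality is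
`centralNormDefect`. In `A` it makes the norm multiplicative on the center, which is then `ℂ` by
Gelfand-Mazur.

Conversely, let `φ` vanish in all `M_n`. A finite-dimensional algebra is zero, has central zero
divisors, or is some `M_n`; hence `relativize φ`, the product of `min |φ| centralZeroDivisor` with
`unitBallRadius`, vanishes in all of them and so in `A`. It remains to see that `centralZeroDivisor`
is positive in `A` when the center is trivial. Its witnesses are only almost central, and
`centerDefect` moves them to the center; that sentence vanishes in finite dimensions by averaging
over the unitary group. -/

/-! ### Boundedness of terms and formulas on the unit ball. -/

theorem CStarTerm.exists_norm_eval_le (A : Type*) [NonUnitalCStarAlgebra A] {n : ℕ}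
    (t : CStarTerm n) : ∃ C : ℝ, ∀ v : Fin n → A, (∀ i, ‖v i‖ ≤ 1) → ‖t.eval v‖ ≤ C := by
  induction t with
  | var i => exact ⟨1, fun v hv => hv i⟩
  | zero => exact ⟨0, fun v _ => by simp [CStarTerm.eval]⟩
  | add s t hs ht =>
    obtain ⟨C, hC⟩ := hs
    obtain ⟨D, hD⟩ := ht
    exact ⟨C + D, fun v hv => norm_add_le_of_le (hC v hv) (hD v hv)⟩
  | mul s t hs ht =>
    obtain ⟨C, hC⟩ := hs
    obtain ⟨D, hD⟩ := ht
    exact ⟨C * D, fun v hv => norm_mul_le_of_le (hC v hv) (hD v hv)⟩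
  | smul c t ht =>
    obtain ⟨C, hC⟩ := ht
    refine ⟨‖c‖ * C, fun v hv => ?_⟩
    rw [CStarTerm.eval, norm_smul]
    exact mul_le_mul_of_nonneg_left (hC v hv) (norm_nonneg c)
  | adjoint t ht =>
    obtain ⟨C, hC⟩ := ht
    exact ⟨C, fun v hv => by simpa [CStarTerm.eval] using hC v hv⟩

theorem Fin.norm_snoc_le {A : Type*} [NonUnitalCStarAlgebra A] {n : ℕ} {v : Fin n → A}
    (hv : ∀ i, ‖v i‖ ≤ 1) {x : A} (hx : ‖x‖ ≤ 1) (i : Fin (n + 1)) :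
    ‖(Fin.snoc v x : Fin (n + 1) → A) i‖ ≤ 1 := by
  refine Fin.lastCases ?_ (fun j => ?_) i
  · simpa using hx
  · simpa using hv j

instance Metric.nonempty_closedBall_zero_one (A : Type*) [NonUnitalCStarAlgebra A] :
    Nonempty (Metric.closedBall (0 : A) 1) := ⟨⟨0, by simp⟩⟩

/-- The values of a formula are bounded as its variables run through the unit ball. -/
theorem CStarFormula.exists_abs_eval_le (A : Type*) [NonUnitalCStarAlgebra A] {n : ℕ}
    (φ : CStarFormula n) :
    ∃ C : ℝ, ∀ v : Fin n → A, (∀ i, ‖v i‖ ≤ 1) → |φ.eval v| ≤ C := by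
  induction φ with
  | atom t =>
    obtain ⟨C, hC⟩ := t.exists_norm_eval_le A
    exact ⟨C, fun v hv => by simpa [CStarFormula.eval] using hC v hv⟩
  | @conn n k u φ ih =>
    choose C hC using ih
    -- A connective is only known to be continuous, so it is bounded on the compact box containing
    -- the values of its arguments.
    have hK : IsCompact (Set.univ.pi fun i => Set.Icc (-C i) (C i)) :=
      isCompact_univ_pi fun i => isCompact_Icc
    obtain ⟨D, hD⟩ := hK.exists_bound_of_continuousOn u.continuous.continuousOn
    exact ⟨D, fun v hv => hD _ fun i _ => abs_le.1 (hC i v hv)⟩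
  | sup φ ih =>
    obtain ⟨C, hC⟩ := ih
    refine ⟨C, fun v hv => ?_⟩
    have h (x : Metric.closedBall (0 : A) 1) : |φ.eval (Fin.snoc v (x : A))| ≤ C :=
      hC _ (Fin.norm_snoc_le hv (mem_closedBall_zero_iff.1 x.2))
    have hb : BddAbove (Set.range fun x : Metric.closedBall (0 : A) 1 =>
        φ.eval (Fin.snoc v (x : A))) := ⟨C, by rintro _ ⟨x, rfl⟩; exact (abs_le.1 (h x)).2⟩
    rw [CStarFormula.eval, abs_le]
    exact ⟨le_ciSup_of_le hb ⟨0, by simp⟩ (abs_le.1 (h _)).1, ciSup_le fun x => (abs_le.1 (h x)).2⟩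
  | inf φ ih =>
    obtain ⟨C, hC⟩ := ih
    refine ⟨C, fun v hv => ?_⟩
    have h (x : Metric.closedBall (0 : A) 1) : |φ.eval (Fin.snoc v (x : A))| ≤ C :=
      hC _ (Fin.norm_snoc_le hv (mem_closedBall_zero_iff.1 x.2))
    have hb : BddBelow (Set.range fun x : Metric.closedBall (0 : A) 1 =>
        φ.eval (Fin.snoc v (x : A))) := ⟨-C, by rintro _ ⟨x, rfl⟩; exact (abs_le.1 (h x)).1⟩
    rw [CStarFormula.eval, abs_le]
    exact ⟨le_ciInf fun x => (abs_le.1 (h x)).1, ciInf_le_of_le hb ⟨0, by simp⟩ (abs_le.1 (h _)).2⟩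

/-! ### Estimating quantified formulas by their instances. -/

namespace CStarFormula

variable {A : Type*} [NonUnitalCStarAlgebra A] {n : ℕ}

theorem le_eval_sup (φ : CStarFormula (n + 1)) {v : Fin n → A} (hv : ∀ i, ‖v i‖ ≤ 1) {x : A}
    (hx : ‖x‖ ≤ 1) : φ.eval (Fin.snoc v x) ≤ φ.sup.eval v := by
  obtain ⟨C, hC⟩ := φ.exists_abs_eval_le A
  refine le_ciSup (f := fun x : Metric.closedBall (0 : A) 1 => φ.eval (Fin.snoc v (x : A)))
    ⟨C, ?_⟩ ⟨x, by simpa using hx⟩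
  rintro _ ⟨y, rfl⟩
  exact (abs_le.1 (hC _ (Fin.norm_snoc_le hv (mem_closedBall_zero_iff.1 y.2)))).2

theorem eval_sup_le (φ : CStarFormula (n + 1)) {v : Fin n → A} {r : ℝ}
    (h : ∀ x : A, ‖x‖ ≤ 1 → φ.eval (Fin.snoc v x) ≤ r) : φ.sup.eval v ≤ r :=
  ciSup_le fun x => h x (mem_closedBall_zero_iff.1 x.2)

theorem eval_inf_le (φ : CStarFormula (n + 1)) {v : Fin n → A} (hv : ∀ i, ‖v i‖ ≤ 1) {x : A}
    (hx : ‖x‖ ≤ 1) : φ.inf.eval v ≤ φ.eval (Fin.snoc v x) := by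
  obtain ⟨C, hC⟩ := φ.exists_abs_eval_le A
  refine ciInf_le (f := fun x : Metric.closedBall (0 : A) 1 => φ.eval (Fin.snoc v (x : A)))
    ⟨-C, ?_⟩ ⟨x, by simpa using hx⟩
  rintro _ ⟨y, rfl⟩
  exact (abs_le.1 (hC _ (Fin.norm_snoc_le hv (mem_closedBall_zero_iff.1 y.2)))).1

theorem le_eval_inf (φ : CStarFormula (n + 1)) {v : Fin n → A} {r : ℝ}
    (h : ∀ x : A, ‖x‖ ≤ 1 → r ≤ φ.eval (Fin.snoc v x)) : r ≤ φ.inf.eval v :=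
  le_ciInf fun x => h x (mem_closedBall_zero_iff.1 x.2)

theorem exists_eval_lt_of_eval_inf_lt (φ : CStarFormula (n + 1)) {v : Fin n → A} {r : ℝ}
    (h : φ.inf.eval v < r) : ∃ x : A, ‖x‖ ≤ 1 ∧ φ.eval (Fin.snoc v x) < r := by
  obtain ⟨x, hx⟩ := exists_lt_of_ciInf_lt h
  exact ⟨x, mem_closedBall_zero_iff.1 x.2, hx⟩

end CStarFormula

/-! ### Invariance of values under *-isomorphism. -/

section Isomorphism

variable {A B : Type*} [NonUnitalCStarAlgebra A] [NonUnitalCStarAlgebra B]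

theorem CStarTerm.eval_comp (f : A →⋆ₙₐ[ℂ] B) {n : ℕ} (t : CStarTerm n) (v : Fin n → A) :
    t.eval (f ∘ v) = f (t.eval v) := by
  induction t with
  | var i => rfl
  | zero => simp [CStarTerm.eval]
  | add s t hs ht => simp [CStarTerm.eval, hs, ht]
  | mul s t hs ht => simp [CStarTerm.eval, hs, ht]
  | smul c t ht => simp [CStarTerm.eval, ht]
  | adjoint t ht => simp [CStarTerm.eval, ht, map_star]

/-- Injective *-homomorphisms are isometric, so `f` matches the unit balls over which the
quantifiers range. -/
theorem CStarFormula.eval_comp (f : A →⋆ₙₐ[ℂ] B) (hf : Function.Bijective f) {n : ℕ}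
    (φ : CStarFormula n) (v : Fin n → A) : φ.eval (f ∘ v) = φ.eval v := by
  have hn (x : A) : ‖f x‖ = ‖x‖ := NonUnitalStarAlgHom.norm_map f hf.1 x
  let g : Metric.closedBall (0 : A) 1 ≃ Metric.closedBall (0 : B) 1 :=
    (Equiv.ofBijective f hf).subtypeEquiv fun x => by simp [hn]
  have hg {m : ℕ} (v : Fin m → A) (x : Metric.closedBall (0 : A) 1) :
      (Fin.snoc (f ∘ v) (g x : B) : Fin (m + 1) → B) = f ∘ (Fin.snoc v (x : A) : Fin (m + 1) → A) := by
    rw [Fin.comp_snoc]; rfl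
  induction φ with
  | atom t => simp [CStarFormula.eval, CStarTerm.eval_comp, hn]
  | conn u φ ih => simp [CStarFormula.eval, ih]
  | sup φ ih =>
    simp only [CStarFormula.eval]
    rw [← g.iSup_comp]
    exact iSup_congr fun x => by rw [hg, ih]
  | inf φ ih =>
    simp only [CStarFormula.eval]
    rw [← g.iInf_comp]
    exact iInf_congr fun x => by rw [hg, ih]

theorem CStarSentence.value_eq_of_bijective (φ : CStarSentence) (f : A →⋆ₙₐ[ℂ] B)
    (hf : Function.Bijective f) : φ.value A = φ.value B := by
  rw [CStarSentence.value, CStarSentence.value, ← φ.eval_comp f hf]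
  congr 1
  exact Subsingleton.elim _ _

end Isomorphism

/-! ### Finite-dimensional C*-algebras: identity and averaging. -/

/-- A C*-algebra with an identity element is unital. -/
@[reducible]
noncomputable def CStarAlgebra.ofIdentity (A : Type*) [inst : NonUnitalCStarAlgebra A] (e : A)
    (he : ∀ a : A, e * a = a ∧ a * e = a) : CStarAlgebra A :=
  let ring : Ring A :=
    { inst with
      one := e
      one_mul := fun a => (he a).1
      mul_one := fun a => (he a).2 }
  { inst, ring with
    algebraMap :=
      { toFun := fun c => c • e
        map_one' := one_smul ℂ e
        map_mul' := fun c d => by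
          change (c * d) • e = (c • e) * (d • e)
          rw [smul_mul_smul_comm, (he e).1]
        map_zero' := zero_smul ℂ e
        map_add' := fun c d => add_smul c d e }
    commutes' := fun c a => by
      change (c • e) * a = a * (c • e)
      rw [smul_mul_assoc, mul_smul_comm, (he a).1, (he a).2]
    smul_def' := fun c a => by
      change c • a = (c • e) * a
      rw [smul_mul_assoc, (he a).1] }

-- The canonical approximate unit lives in the unit ball, which is compact here; any cluster point
-- is an identity.
open Filter Topology in
theorem NonUnitalCStarAlgebra.exists_identity_of_finiteDimensional (F : Type*)
    [NonUnitalCStarAlgebra F] [FiniteDimensional ℂ F] :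
    ∃ e : F, ‖e‖ ≤ 1 ∧ ∀ a : F, e * a = a ∧ a * e = a := by
  let _ := CStarAlgebra.spectralOrder F
  have := CStarAlgebra.spectralOrderedRing F
  have := FiniteDimensional.proper ℂ F
  have hl := CStarAlgebra.increasingApproximateUnit F
  have := hl.neBot
  obtain ⟨e, he, hc⟩ := (isCompact_closedBall (0 : F) 1).exists_clusterPt
    (le_principal_iff.2 hl.closedBall_mem)
  have : NeBot (𝓝 e ⊓ CStarAlgebra.approximateUnit F) := hc
  refine ⟨e, mem_closedBall_zero_iff.1 he, fun a => ⟨?_, ?_⟩⟩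
  · exact tendsto_nhds_unique (((continuous_mul_const a).tendsto e).mono_left inf_le_left)
      ((hl.tendsto_mul_right a).mono_left inf_le_right)
  · exact tendsto_nhds_unique (((continuous_const_mul a).tendsto e).mono_left inf_le_left)
      ((hl.tendsto_mul_left a).mono_left inf_le_right)

open MeasureTheory in
/-- Averaging over the unitary group approximates an element of a finite-dimensional C*-algebra by
a central element. -/
theorem CStarAlgebra.exists_commute_norm_sub_le_of_finiteDimensional (F : Type*) [CStarAlgebra F]
    [FiniteDimensional ℂ F] (a : F) {r : ℝ} (hr : ∀ b : F, ‖b‖ ≤ 1 → ‖a * b - b * a‖ ≤ r) :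
    ∃ z : F, ‖z‖ ≤ ‖a‖ ∧ (∀ b : F, z * b = b * z) ∧ ‖a - z‖ ≤ r := by
  have := FiniteDimensional.proper ℂ F
  have hnorm (u : unitary F) : ‖(u : F)‖ ≤ 1 := by
    nontriviality F
    exact (CStarRing.norm_coe_unitary u).le
  have : CompactSpace (unitary F) := by
    refine isCompact_iff_compactSpace.1 (Metric.isCompact_of_isClosed_isBounded
      (isClosed_unitary) ((Metric.isBounded_closedBall (x := (0 : F)) (r := 1)).subset
      fun u hu => ?_))
    simpa using hnorm ⟨u, hu⟩
  let _ : MeasurableSpace (unitary F) := borel _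
  have : BorelSpace (unitary F) := ⟨rfl⟩
  let μ : Measure (unitary F) := Measure.haarMeasure ⊤
  have : IsProbabilityMeasure μ := ⟨by
    simpa using Measure.haarMeasure_self (K₀ := (⊤ : TopologicalSpace.PositiveCompacts (unitary F)))⟩
  let f : unitary F → F := fun u => u * a * star (u : F)
  have hf : Continuous f := by fun_prop
  have hfi : Integrable f μ := hf.integrable_of_hasCompactSupport (HasCompactSupport.of_compactSpace _)
  have hfa (u : unitary F) : ‖f u‖ ≤ ‖a‖ := by
    have h := CStarRing.norm_mul_coe_unitary ((u : F) * a) (star u)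
    rw [Unitary.coe_star, CStarRing.norm_coe_unitary_mul] at h
    exact h.le
  refine ⟨∫ u, f u ∂μ, ?_, ?_, ?_⟩
  · simpa using norm_integral_le_of_norm_le_const (μ := μ) (Filter.Eventually.of_forall hfa)
  -- Invariance of Haar measure makes the average commute with every unitary, and the unitaries span
  -- `F`.
  · have key (v : unitary F) : (v : F) * (∫ u, f u ∂μ) = (∫ u, f u ∂μ) * v := by
      have h : (v : F) * (∫ u, f u ∂μ) * star (v : F) = ∫ u, f u ∂μ := by
        rw [← integral_const_mul_of_integrable hfi, ← integral_mul_const_of_integrable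
          (hfi.const_mul _)]
        rw [← integral_mul_left_eq_self f v]
        congr 1
        ext u
        simp [f, mul_assoc]
      calc (v : F) * (∫ u, f u ∂μ) = (v : F) * (∫ u, f u ∂μ) * (star (v : F) * v) := by simp
        _ = _ := by rw [← mul_assoc, h]
    intro b
    have hb : b ∈ Submodule.span ℂ (unitary F : Set F) := by
      rw [CStarAlgebra.span_unitary]; trivial
    induction hb using Submodule.span_induction with
    | mem x hx => exact (key ⟨x, hx⟩).symm
    | zero => simp
    | add x y _ _ hx hy => rw [mul_add, add_mul, hx, hy]
    | smul c x _ hx => rw [mul_smul_comm, smul_mul_assoc, hx]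
  · have h (u : unitary F) : ‖a - f u‖ ≤ r := by
      have h1 : a - f u = (a * u - u * a) * star (u : F) := by
        simp [f, sub_mul, mul_assoc]
      rw [h1]
      calc _ ≤ ‖a * (u : F) - u * a‖ * ‖star (u : F)‖ := norm_mul_le _ _
        _ ≤ r * 1 := mul_le_mul (hr u (hnorm u)) (by simpa using hnorm u) (norm_nonneg _)
            ((norm_nonneg _).trans (hr u (hnorm u)))
        _ = r := mul_one r
    have h2 : a - ∫ u, f u ∂μ = ∫ u, (a - f u) ∂μ := by
      rw [integral_sub (integrable_const a) hfi]; simp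
    rw [h2]
    simpa using norm_integral_le_of_norm_le_const (μ := μ) (Filter.Eventually.of_forall h)

theorem NonUnitalCStarAlgebra.exists_commute_norm_sub_le_of_finiteDimensional (F : Type*)
    [NonUnitalCStarAlgebra F] [FiniteDimensional ℂ F] (a : F) {r : ℝ}
    (hr : ∀ b : F, ‖b‖ ≤ 1 → ‖a * b - b * a‖ ≤ r) :
    ∃ z : F, ‖z‖ ≤ ‖a‖ ∧ (∀ b : F, z * b = b * z) ∧ ‖a - z‖ ≤ r := by
  obtain ⟨e, -, he⟩ := NonUnitalCStarAlgebra.exists_identity_of_finiteDimensional F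
  let _ := CStarAlgebra.ofIdentity F e he
  exact CStarAlgebra.exists_commute_norm_sub_le_of_finiteDimensional F a hr

/-! ### Spectral and minimal projections in finite dimension. -/

namespace CStarAlgebra

variable {F : Type*} [CStarAlgebra F] [FiniteDimensional ℂ F]

theorem finite_spectrum_real_of_finiteDimensional (a : F) : (spectrum ℝ a).Finite := by
  nontriviality F
  have : FiniteDimensional ℝ F := FiniteDimensional.trans ℝ ℂ F
  have ha : IsIntegral ℝ a := Algebra.IsIntegral.isIntegral a
  refine ((minpoly ℝ a).rootSet_finite ℝ).subset fun r hr => ?_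
  rw [Polynomial.mem_rootSet]
  refine ⟨minpoly.ne_zero ha, ?_⟩
  have h := spectrum.subset_polynomial_aeval a (minpoly ℝ a) ⟨r, hr, rfl⟩
  rw [minpoly.aeval, spectrum.zero_eq] at h
  simpa using h

/-- The spectrum is finite, so the indicator of a nonzero spectral value is continuous on it;
functional calculus yields the spectral projection. -/
theorem exists_projection_mul_eq_smul {a : F} (ha : IsSelfAdjoint a) (h0 : a ≠ 0) :
    ∃ q : F, ∃ c : ℂ, star q = q ∧ q * q = q ∧ q ≠ 0 ∧ c ≠ 0 ∧ a * q = c • q := by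
  have hfin := finite_spectrum_real_of_finiteDimensional a
  have hc (f : ℝ → ℝ) : ContinuousOn f (spectrum ℝ a) := hfin.continuousOn f
  obtain ⟨r, hr, hr0⟩ : ∃ r ∈ spectrum ℝ a, r ≠ 0 := by
    by_contra! h
    refine h0 ?_
    rw [← cfc_id' ℝ a, cfc_congr (g := fun _ => 0) (fun x hx => h x hx), cfc_const_zero]
  let f : ℝ → ℝ := fun x => if x = r then 1 else 0
  refine ⟨cfc f a, (r : ℂ), (cfc_predicate f a).star_eq, ?_, ?_, by exact_mod_cast hr0, ?_⟩
  · rw [← cfc_mul f f a (hc _) (hc _)]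
    congr 1
    ext x
    simp [f]
  · intro h
    have h1 : (1 : ℝ) ∈ spectrum ℝ (cfc f a) := by
      rw [cfc_map_spectrum f a ha (hc _)]
      exact ⟨r, hr, by simp [f]⟩
    have : Nontrivial F := ⟨a, 0, h0⟩
    rw [h, spectrum.zero_eq] at h1
    simp at h1
  · calc a * cfc f a = cfc (fun x => x * f x) a := by
          rw [cfc_mul (fun x => x) f a (hc _) (hc _), cfc_id' ℝ a]
      _ = cfc (fun x => r * f x) a := by
          congr 1
          ext x
          by_cases hx : x = r <;> simp [f, hx]
      _ = (r : ℂ) • cfc f a := by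
          rw [cfc_const_mul r f a (hc _)]; simp

-- Take a nonzero projection `p` with the right ideal `pF` of least dimension. A spectral projection
-- of a nonzero self-adjoint element of `pFp` lies under `p`, hence equals `p`; general elements
-- split into self-adjoint parts.
variable (F) in
theorem exists_minimal_projection [Nontrivial F] :
    ∃ p : F, p ≠ 0 ∧ star p = p ∧ p * p = p ∧ ∀ a : F, p * a * p = a → ∃ c : ℂ, a = c • p := by
  let S : Set F := {p | p ≠ 0 ∧ star p = p ∧ p * p = p}
  have hS : S.Nonempty := ⟨1, one_ne_zero, star_one F, one_mul 1⟩
  let d : F → ℕ := fun p => Module.finrank ℂ (LinearMap.mulLeft ℂ p).range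
  let p := Function.argminOn d S hS
  obtain ⟨hp0, hps, hpp⟩ : p ∈ S := Function.argminOn_mem d S hS
  have hmin {q : F} (hq : q ∈ S) (hpq : p * q = q) : q = p := by
    have hle : (LinearMap.mulLeft ℂ q).range ≤ (LinearMap.mulLeft ℂ p).range := by
      rintro _ ⟨x, rfl⟩
      exact ⟨q * x, by simp [← mul_assoc, hpq]⟩
    have heq := Submodule.eq_of_le_of_finrank_le hle (Function.argminOn_le d S hq)
    obtain ⟨x, hx⟩ : p ∈ (LinearMap.mulLeft ℂ q).range := by
      rw [heq]; exact ⟨p, hpp⟩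
    have hqp : q * p = p := by
      rw [← hx, LinearMap.mulLeft_apply, ← mul_assoc, hq.2.2]
    have h := congrArg star hpq
    rw [star_mul, hps, hq.2.1, hqp] at h
    exact h.symm
  have hsa {a : F} (hsa : IsSelfAdjoint a) (ha : p * a * p = a) : ∃ c : ℂ, a = c • p := by
    by_cases h0 : a = 0
    · exact ⟨0, by simp [h0]⟩
    obtain ⟨q, c, hqs, hqq, hq0, hc, hcq⟩ := exists_projection_mul_eq_smul hsa h0
    have hpa : p * a = a := by rw [← ha, mul_assoc p a p, ← mul_assoc p p, hpp]
    have hap : a * p = a := by rw [← ha, mul_assoc _ p p, hpp]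
    have hq : q = c⁻¹ • (a * q) := by rw [hcq, inv_smul_smul₀ hc]
    have hpq : p * q = q := by
      rw [hq, mul_smul_comm, ← mul_assoc, hpa]
    rw [hmin ⟨hq0, hqs, hqq⟩ hpq, hap] at hcq
    exact ⟨c, hcq⟩
  refine ⟨p, hp0, hps, hpp, fun a ha => ?_⟩
  have ha' : p * star a * p = star a := by
    simpa only [star_mul, hps, ← mul_assoc] using congrArg star ha
  obtain ⟨c, hc⟩ := hsa (a := a + star a) (by simp [IsSelfAdjoint, add_comm])
    (by rw [mul_add, add_mul, ha, ha'])
  obtain ⟨e, he⟩ := hsa (a := Complex.I • (a - star a))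
    (by simp [IsSelfAdjoint, star_smul, ← smul_neg])
    (by rw [mul_smul_comm, smul_mul_assoc, mul_sub, sub_mul, ha, ha'])
  refine ⟨(1 / 2) * (c - Complex.I * e), ?_⟩
  rw [mul_smul, sub_smul, mul_smul, ← hc, ← he, smul_smul, Complex.I_mul_I]
  module

end CStarAlgebra

/-! ### Matrix algebras from matrix units. -/

section MatrixUnits

variable {A : Type*} [NonUnitalCStarAlgebra A] {n : ℕ}

/-- The homomorphism from a matrix algebra given by the matrix units `w i * star (w j)`. -/
noncomputable def matrixUnitsHom (p : A) (w : Fin n → A)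
    (hw : ∀ i j, star (w i) * w j = if i = j then p else 0) (hp : ∀ i, w i * p = w i) :
    Matrix (Fin n) (Fin n) ℂ →⋆ₙₐ[ℂ] A where
  toFun m := ∑ i, ∑ j, m i j • (w i * star (w j))
  map_smul' c m := by simp [Finset.smul_sum, mul_smul]
  map_zero' := by simp
  map_add' m m' := by simp [Finset.sum_add_distrib, add_smul]
  map_star' m := by
    simp only [star_sum, star_smul, star_mul, star_star, Matrix.star_apply]
    exact Finset.sum_comm
  map_mul' m m' := by
    have h (i j k l : Fin n) : (w i * star (w j)) * (w k * star (w l)) =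
        if j = k then w i * star (w l) else 0 := by
      rw [mul_assoc, ← mul_assoc (star (w j)), hw]
      split_ifs
      · rw [← mul_assoc, hp]
      · simp
    have h' (i j : Fin n) : (m i j • (w i * star (w j))) * (∑ k, ∑ l, m' k l • (w k * star (w l))) =
        ∑ l, (m i j * m' j l) • (w i * star (w l)) := by
      rw [Finset.mul_sum, Finset.sum_eq_single j]
      · simp [Finset.mul_sum, smul_mul_smul_comm, h]
      · intro k _ hk
        simp [Finset.mul_sum, smul_mul_smul_comm, h, hk.symm]
      · simp
    simp only [Finset.sum_mul, h', Matrix.mul_apply, Finset.sum_smul]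
    exact Finset.sum_congr rfl fun i _ => Finset.sum_comm

theorem matrixUnitsHom_apply (p : A) (w : Fin n → A)
    (hw : ∀ i j, star (w i) * w j = if i = j then p else 0) (hp : ∀ i, w i * p = w i)
    (m : Matrix (Fin n) (Fin n) ℂ) :
    matrixUnitsHom p w hw hp m = ∑ i, ∑ j, m i j • (w i * star (w j)) := rfl

theorem matrixUnitsHom_mul (p : A) (w : Fin n → A)
    (hw : ∀ i j, star (w i) * w j = if i = j then p else 0) (hp : ∀ i, w i * p = w i)
    (m : Matrix (Fin n) (Fin n) ℂ) (l : Fin n) :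
    matrixUnitsHom p w hw hp m * w l = ∑ i, m i l • w i := by
  simp [matrixUnitsHom_apply, Finset.sum_mul, smul_mul_assoc, mul_assoc, hw, mul_ite, hp]

theorem matrixUnitsHom_injective (p : A) (w : Fin n → A)
    (hw : ∀ i j, star (w i) * w j = if i = j then p else 0) (hp : ∀ i, w i * p = w i)
    (hp0 : p ≠ 0) : Function.Injective (matrixUnitsHom p w hw hp) := by
  refine (injective_iff_map_eq_zero _).2 fun m hm => ?_
  ext k l
  have h : star (w k) * (matrixUnitsHom p w hw hp m * w l) = m k l • p := by
    simp [matrixUnitsHom_mul, Finset.mul_sum, mul_smul_comm, hw]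
  rw [hm, zero_mul, mul_zero] at h
  simpa [hp0] using h.symm

/-- If a C*-algebra has no central zero divisors, matrix units whose column spaces absorb left
multiplication exhaust it. -/
theorem matrixUnitsHom_surjective (p : A) (w : Fin n → A)
    (hw : ∀ i j, star (w i) * w j = if i = j then p else 0) (hp : ∀ i, w i * p = w i)
    (hn : 0 < n) (hp0 : p ≠ 0) (hspan : ∀ a : A, ∃ m : Matrix (Fin n) (Fin n) ℂ,
      ∀ j, a * w j = ∑ i, m i j • w i)
    (hA : ∀ z x : A, (∀ b, z * b = b * z) → z * x = 0 → z = 0 ∨ x = 0) :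
    Function.Surjective (matrixUnitsHom p w hw hp) := by
  set f := matrixUnitsHom p w hw hp
  have hmul (a : A) : ∃ m, a * f 1 = f m := by
    obtain ⟨m, hm⟩ := hspan a
    refine ⟨m, ?_⟩
    have h1 : f 1 = ∑ j, w j * star (w j) := by
      simp [f, matrixUnitsHom_apply, Matrix.one_apply, ite_smul]
    rw [h1, Finset.mul_sum, matrixUnitsHom_apply, Finset.sum_comm]
    exact Finset.sum_congr rfl fun j _ => by
      rw [← mul_assoc, hm, Finset.sum_mul]
      simp only [smul_mul_assoc]
  have hone (m) : f 1 * f m = f m := by rw [← map_mul, one_mul]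
  have hcompress (a : A) : f 1 * (a * f 1) = a * f 1 := by
    obtain ⟨m, hm⟩ := hmul a
    rw [hm, hone]
  have hstar : star (f 1) = f 1 := by rw [← map_star, star_one]
  -- Adjoints turn invariance of the left ideal of `f 1` into commutation: `f 1` is a nonzero
  -- central projection, and it kills `f m - a` below.
  have hcomm (a : A) : f 1 * a = a * f 1 := by
    have h := congrArg star (hcompress (star a))
    simp only [star_mul, star_star, hstar] at h
    rw [← h, mul_assoc, hcompress]
  have h10 : f 1 ≠ 0 := by
    have : NeZero n := ⟨hn.ne'⟩
    intro h
    have h' := (matrixUnitsHom_injective p w hw hp hp0) (h.trans (map_zero f).symm)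
    exact one_ne_zero h'
  intro a
  obtain ⟨m, hm⟩ := hmul a
  refine ⟨m, ?_⟩
  have h0 : f 1 * (f m - a) = 0 := by rw [mul_sub, hone, hcomm a, hm, sub_self]
  exact sub_eq_zero.1 ((hA _ _ hcomm h0).resolve_left h10)

end MatrixUnits

/-! ### Recognizing full matrix algebras. -/

/-- The left ideal generated by an idempotent. -/
def leftIdealOfIdempotent {F : Type*} [CStarAlgebra F] (p : F) : Submodule ℂ F where
  carrier := {x | x * p = x}
  add_mem' hx hy := by
    simp only [Set.mem_ofPred_eq] at hx hy ⊢
    rw [add_mul, hx, hy]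
  zero_mem' := zero_mul p
  smul_mem' c x hx := by
    simp only [Set.mem_ofPred_eq] at hx ⊢
    rw [smul_mul_assoc, hx]

open ComplexOrder in
theorem Complex.nonneg_of_star_mul_self_eq_smul {F : Type*} [CStarAlgebra F] {p x : F} (hp0 : p ≠ 0)
    (hps : star p = p) (hpp : p * p = p) {c : ℂ} (h : star x * x = c • p) : 0 ≤ c := by
  let _ := CStarAlgebra.spectralOrder F
  have := CStarAlgebra.spectralOrderedRing F
  have hp : 0 ≤ p := by
    have := star_mul_self_nonneg p
    rwa [hps, hpp] at this
  have hc : star c = c := by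
    have := congrArg star h
    rw [star_mul, star_star, star_smul, hps, h] at this
    exact (smul_left_injective ℂ hp0 this).symm
  obtain ⟨r, rfl⟩ := Complex.conj_eq_iff_real.1 hc
  have hx : (0 : F) ≤ (r : ℂ) • p := h ▸ star_mul_self_nonneg x
  by_contra hr
  have hr : r < 0 := by simpa using hr
  have hx' : (0 : F) ≤ (-r) • p := smul_nonneg (by linarith) hp
  have hx : (0 : F) ≤ r • p := by simpa using hx
  have h0 : r • p = 0 := le_antisymm (by simpa using hx') hx
  exact (smul_ne_zero hr.ne hp0) h0

/-- The left ideal of a minimal projection `p` is a Hilbert space with respect to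
`⟪x, y⟫ • p = star x * y`. -/
theorem exists_orthonormal_leftIdeal {F : Type*} [CStarAlgebra F] [FiniteDimensional ℂ F] {p : F}
    (hp0 : p ≠ 0) (hps : star p = p) (hpp : p * p = p)
    (hp : ∀ a : F, p * a * p = a → ∃ c : ℂ, a = c • p) :
    ∃ n : ℕ, ∃ w : Fin n → F, 0 < n ∧ (∀ i j, star (w i) * w j = if i = j then p else 0) ∧
      (∀ i, w i * p = w i) ∧ ∀ x : F, x * p = x → ∃ c : Fin n → ℂ, x = ∑ i, c i • w i := by
  let H := leftIdealOfIdempotent p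
  have hex (x y : H) : ∃ c : ℂ, star (x : F) * y = c • p := by
    refine hp _ ?_
    have h : p * star (x : F) = star (x : F) := by
      have := congrArg star (show (x : F) * p = x from x.2)
      rwa [star_mul, hps] at this
    rw [← mul_assoc, h, mul_assoc, show (y : F) * p = y from y.2]
  choose c hc using hex
  have huniq {d e : ℂ} (h : d • p = e • p) : d = e := smul_left_injective ℂ hp0 h
  have hpn : ‖p‖ = 1 := by
    have h := CStarRing.norm_star_mul_self (x := p)
    rw [hps, hpp] at h
    exact (mul_eq_left₀ (norm_ne_zero_iff.2 hp0)).1 h.symm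
  -- The norm is the one inherited from `F`; it agrees with the inner product because `‖p‖ = 1`.
  let _ : InnerProductSpace ℂ H :=
    { inner := c
      norm_sq_eq_re_inner := fun x => by
        have h0 := Complex.nonneg_of_star_mul_self_eq_smul hp0 hps hpp (hc x x)
        have h := CStarRing.norm_star_mul_self (x := (x : F))
        rw [hc, norm_smul, hpn, mul_one, ← Complex.re_eq_norm.2 h0, ← sq] at h
        exact h.symm
      conj_inner_symm := fun x y => huniq (by
        rw [← hc]
        have := congrArg star (hc y x)
        rw [star_mul, star_star, star_smul, hps] at this
        exact this.symm)
      add_left := fun x y z => huniq (by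
        rw [← hc, add_smul, ← hc, ← hc, Submodule.coe_add, star_add, add_mul])
      smul_left := fun x y r => huniq (by
        rw [← hc, mul_smul, ← hc, Submodule.coe_smul, star_smul, smul_mul_assoc]
        rfl) }
  let b := stdOrthonormalBasis ℂ H
  have hcb (x y : H) : star (x : F) * y = inner ℂ x y • p := hc x y
  refine ⟨_, fun i => (b i : F), ?_, fun i j => ?_, fun i => (b i).2, fun x hx => ?_⟩
  · have : Nontrivial H := ⟨⟨p, hpp⟩, 0, fun h => hp0 (congrArg Subtype.val h)⟩
    exact Module.finrank_pos
  · rw [hcb, orthonormal_iff_ite.1 b.orthonormal]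
    simp
  · refine ⟨fun i => inner ℂ (b i) ⟨x, hx⟩, ?_⟩
    have h := congrArg Subtype.val (b.sum_repr' ⟨x, hx⟩)
    simpa using h.symm

/-- An orthonormal basis `w` of the left ideal `Fp`, for a minimal projection `p`, gives matrix
units `w i * star (w j)`; the absence of central zero divisors forces them to span `F`. -/
theorem NonUnitalCStarAlgebra.exists_bijective_matrix_of_finiteDimensional (F : Type*)
    [NonUnitalCStarAlgebra F] [FiniteDimensional ℂ F] [Nontrivial F]
    (hF : ∀ z x : F, (∀ b, z * b = b * z) → z * x = 0 → z = 0 ∨ x = 0) :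
    ∃ n : ℕ, 0 < n ∧ ∃ f : Matrix (Fin n) (Fin n) ℂ →⋆ₙₐ[ℂ] F, Function.Bijective f := by
  obtain ⟨e, -, he⟩ := NonUnitalCStarAlgebra.exists_identity_of_finiteDimensional F
  let _ := CStarAlgebra.ofIdentity F e he
  obtain ⟨p, hp0, hps, hpp, hp⟩ := CStarAlgebra.exists_minimal_projection F
  obtain ⟨n, w, hn, hw, hwp, hspan⟩ := exists_orthonormal_leftIdeal hp0 hps hpp hp
  refine ⟨n, hn, matrixUnitsHom p w hw hwp, matrixUnitsHom_injective p w hw hwp hp0,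
    matrixUnitsHom_surjective p w hw hwp hn hp0 (fun a => ?_) hF⟩
  choose c hc using fun j => hspan (a * w j) (by rw [mul_assoc, hwp])
  exact ⟨fun i j => c j i, hc⟩

/-- Quantifiers see only the unit ball; this extends homogeneous conclusions to all of `A`. -/
theorem CStarAlgebra.forall_of_forall_norm_le_one {A : Type*} [NonUnitalCStarAlgebra A]
    {P : A → Prop} (h : ∀ x, ‖x‖ ≤ 1 → P x) (hs : ∀ (c : ℂ) x, P x → P (c • x)) (x : A) : P x := by
  have h0 : (0 : ℝ) < ‖x‖ + 1 := by positivity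
  have h0' : ((‖x‖ + 1 : ℝ) : ℂ) ≠ 0 := by exact_mod_cast h0.ne'
  rw [← smul_inv_smul₀ h0' x]
  refine hs _ _ (h _ ?_)
  rw [norm_smul, norm_inv, Complex.norm_real, Real.norm_of_nonneg h0.le, inv_mul_le_one₀ h0]
  linarith

/-! ### Inner derivations as a measure of non-centrality. -/

/-- The norm of the inner derivation `b ↦ a * b - b * a`. -/
noncomputable def derivationNorm {A : Type*} [NonUnitalCStarAlgebra A] (a : A) : ℝ :=
  ⨆ b : Metric.closedBall (0 : A) 1, ‖a * b - b * a‖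

section DerivationNorm

variable {A : Type*} [NonUnitalCStarAlgebra A]

theorem le_derivationNorm (a : A) {b : A} (hb : ‖b‖ ≤ 1) : ‖a * b - b * a‖ ≤ derivationNorm a := by
  refine le_ciSup (f := fun b : Metric.closedBall (0 : A) 1 => ‖a * b - b * a‖)
    ⟨‖a‖ * 1 + 1 * ‖a‖, ?_⟩ ⟨b, by simpa using hb⟩
  rintro _ ⟨c, rfl⟩
  have hc := mem_closedBall_zero_iff.1 c.2
  exact norm_sub_le_of_le (norm_mul_le_of_le le_rfl hc) (norm_mul_le_of_le hc le_rfl)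

theorem derivationNorm_le {a : A} {r : ℝ} (h : ∀ b : A, ‖b‖ ≤ 1 → ‖a * b - b * a‖ ≤ r) :
    derivationNorm a ≤ r :=
  ciSup_le fun b => h b (mem_closedBall_zero_iff.1 b.2)

theorem derivationNorm_nonneg (a : A) : 0 ≤ derivationNorm a := by
  simpa using le_derivationNorm a (b := 0) (by simp)

theorem derivationNorm_eq_zero_iff {a : A} : derivationNorm a = 0 ↔ ∀ b : A, a * b = b * a := by
  constructor
  · refine fun h => CStarAlgebra.forall_of_forall_norm_le_one (fun b hb => ?_) fun c b hb => ?_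
    · exact sub_eq_zero.1 (norm_le_zero_iff.1 (h ▸ le_derivationNorm a hb))
    · rw [mul_smul_comm, smul_mul_assoc, hb]
  · exact fun h => le_antisymm (derivationNorm_le fun b _ => by simp [h]) (derivationNorm_nonneg a)

theorem derivationNorm_le_add_of_norm_sub_le {a b : A} :
    derivationNorm a ≤ derivationNorm b + 2 * ‖a - b‖ := by
  refine derivationNorm_le fun c hc => ?_
  have h : a * c - c * a = (b * c - c * b) + ((a - b) * c - c * (a - b)) := by noncomm_ring
  rw [h, two_mul]
  refine norm_add_le_of_le (le_derivationNorm b hc) (norm_sub_le_of_le ?_ ?_)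
  · exact (norm_mul_le _ _).trans (mul_le_of_le_one_right (norm_nonneg _) hc)
  · exact (norm_mul_le _ _).trans (mul_le_of_le_one_left (norm_nonneg _) hc)

end DerivationNorm

/-! ### The sentences used for the transfer. -/

namespace CStarFormula

/-- The formula expressing the norm of the inner derivation given by `xᵢ`. -/
def innerDerivation {n : ℕ} (i : Fin n) : CStarFormula n :=
  sup (atom (.add (.mul (.var i.castSucc) (.var (Fin.last n)))
    (.smul (-1) (.mul (.var (Fin.last n)) (.var i.castSucc)))))

theorem eval_innerDerivation {A : Type*} [NonUnitalCStarAlgebra A] {n : ℕ} (i : Fin n)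
    (v : Fin n → A) : (innerDerivation i).eval v = derivationNorm (v i) := by
  simp [innerDerivation, derivationNorm, eval, CStarTerm.eval, sub_eq_add_neg]

theorem norm_snoc_elim0_le {A : Type*} [NonUnitalCStarAlgebra A] {x : A} (hx : ‖x‖ ≤ 1) (i : Fin 1) :
    ‖(Fin.snoc Fin.elim0 x : Fin 1 → A) i‖ ≤ 1 :=
  Fin.norm_snoc_le (fun i => i.elim0) hx i

end CStarFormula

namespace CStarSentence

open CStarFormula

/-- The sentence expressing the existence of an approximate identity element. -/
noncomputable def identityDefect : CStarSentence :=
  inf (sup (conn ⟨fun y : Fin 2 → ℝ => y 0 + y 1, by fun_prop⟩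
    ![atom (.add (.mul (.var 0) (.var 1)) (.smul (-1) (.var 1))),
      atom (.add (.mul (.var 1) (.var 0)) (.smul (-1) (.var 1)))]))

/-- The sentence expressing that elements with a small inner derivation are close to elements with
an arbitrarily small inner derivation. -/
noncomputable def centerDefect : CStarSentence :=
  sup (inf (conn ⟨fun y : Fin 3 → ℝ => max (y 0 - y 1) 0 + y 2, by fun_prop⟩
    ![atom (.add (.var 0) (.smul (-1) (.var 1))), innerDerivation 0, innerDerivation 1]))

/-- The sentence that vanishes if there are almost central zero divisors. -/
noncomputable def centralZeroDivisor : CStarSentence :=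
  inf (inf (conn ⟨fun y : Fin 4 → ℝ => y 0 + |1 - y 1| + |1 - y 2| + y 3, by fun_prop⟩
    ![atom (.mul (.var 0) (.var 1)), atom (.var 0), atom (.var 1), innerDerivation 0]))

/-- The sentence expressing that multiplication by a central element multiplies norms. -/
noncomputable def centralNormDefect : CStarSentence :=
  sup (sup (conn ⟨fun y : Fin 4 → ℝ => max (y 1 * y 2 - y 0 - 2 * y 3) 0, by fun_prop⟩
    ![atom (.mul (.var 0) (.var 1)), atom (.var 0), atom (.var 1), innerDerivation 0]))

/-- The sentence whose value is the radius of the unit ball: zero in the zero algebra, and one in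
every other algebra. -/
def unitBallRadius : CStarSentence := sup (atom (.var 0))

/-- The sentence expressing that `φ` vanishes, or there are almost central zero divisors, or the
algebra is zero. -/
noncomputable def relativize (φ : CStarSentence) : CStarSentence :=
  conn ⟨fun y : Fin 3 → ℝ => min |y 0| (y 1) * y 2, by fun_prop⟩
    ![φ, centralZeroDivisor, unitBallRadius]

end CStarSentence

/-! ### Meaning of the sentences in a given algebra. -/

section Values

open CStarFormula CStarSentence

variable (A : Type*) [NonUnitalCStarAlgebra A]

theorem exists_identity_of_value_identityDefect (h : identityDefect.value A = 0) :
    ∃ e : A, ‖e‖ ≤ 1 ∧ ∀ a : A, e * a = a ∧ a * e = a := by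
  have happrox (n : ℕ) : ∃ e : A, ‖e‖ ≤ 1 ∧ ∀ x : A, ‖x‖ ≤ 1 →
      ‖e * x - x‖ + ‖x * e - x‖ ≤ 1 / ((n : ℝ) + 1) := by
    obtain ⟨e, he, h'⟩ := exists_eval_lt_of_eval_inf_lt _ (lt_of_eq_of_lt h
      (show (0 : ℝ) < 1 / ((n : ℝ) + 1) by positivity))
    refine ⟨e, he, fun x hx => ?_⟩
    refine le_trans (le_of_eq ?_) ((le_eval_sup _ (norm_snoc_elim0_le he) hx).trans h'.le)
    simp [CStarFormula.eval, CStarTerm.eval, Fin.snoc, sub_eq_add_neg]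
  choose e he hx using happrox
  have hlim : Filter.Tendsto (fun n : ℕ => 1 / ((n : ℝ) + 1)) Filter.atTop (nhds 0) :=
    tendsto_one_div_add_atTop_nhds_zero_nat
  have hcauchy : CauchySeq e := by
    refine cauchySeq_of_le_tendsto_0 (fun n : ℕ => 1 / ((n : ℝ) + 1) + 1 / ((n : ℝ) + 1))
      (fun n m N hn hm => ?_) (by simpa using hlim.add hlim)
    -- The product `e n * e m` is close to both factors: `e n` is almost a left identity and `e m`
    -- almost a right one.
    have h1 : ‖e n * e m - e m‖ ≤ 1 / ((N : ℝ) + 1) :=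
      (le_add_of_nonneg_right (norm_nonneg _)).trans ((hx n (e m) (he m)).trans
        (one_div_le_one_div_of_le (by positivity) (by gcongr)))
    have h2 : ‖e n * e m - e n‖ ≤ 1 / ((N : ℝ) + 1) :=
      (le_add_of_nonneg_left (norm_nonneg _)).trans ((hx m (e n) (he n)).trans
        (one_div_le_one_div_of_le (by positivity) (by gcongr)))
    rw [dist_eq_norm, show e n - e m = (e n * e m - e m) - (e n * e m - e n) by abel]
    exact norm_sub_le_of_le h1 h2
  obtain ⟨a, ha⟩ := cauchySeq_tendsto_of_complete hcauchy
  refine ⟨a, le_of_tendsto ha.norm (Filter.Eventually.of_forall he), ?_⟩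
  refine CStarAlgebra.forall_of_forall_norm_le_one (fun x hx1 => ⟨?_, ?_⟩) fun c x hcx => ?_
  · refine tendsto_nhds_unique (ha.mul_const x) (tendsto_iff_norm_sub_tendsto_zero.2
      (squeeze_zero (fun n => norm_nonneg _) (fun n => ?_) hlim))
    exact (le_add_of_nonneg_right (norm_nonneg _)).trans (hx n x hx1)
  · refine tendsto_nhds_unique (ha.const_mul x) (tendsto_iff_norm_sub_tendsto_zero.2
      (squeeze_zero (fun n => norm_nonneg _) (fun n => ?_) hlim))
    exact (le_add_of_nonneg_left (norm_nonneg _)).trans (hx n x hx1)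
  · rw [mul_smul_comm, smul_mul_assoc, hcx.1, hcx.2]
    exact ⟨rfl, rfl⟩

theorem value_identityDefect_of_finiteDimensional [FiniteDimensional ℂ A] :
    identityDefect.value A = 0 := by
  obtain ⟨e, he1, he⟩ := NonUnitalCStarAlgebra.exists_identity_of_finiteDimensional A
  refine le_antisymm ?_ ?_
  · refine (eval_inf_le _ (fun i => i.elim0) he1).trans (eval_sup_le _ fun x _ => le_of_eq ?_)
    simp [CStarFormula.eval, CStarTerm.eval, Fin.snoc, he]
  · refine le_eval_inf _ fun x hx => le_trans ?_
      (le_eval_sup _ (norm_snoc_elim0_le hx) (x := 0) (by simp))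
    simp [CStarFormula.eval, CStarTerm.eval, Fin.snoc]

open NonUnitalCStarAlgebra in
theorem value_centerDefect_of_finiteDimensional [FiniteDimensional ℂ A] :
    centerDefect.value A = 0 := by
  refine le_antisymm ?_ ?_
  · refine eval_sup_le _ fun a ha => ?_
    obtain ⟨z, hz1, hz, hza⟩ := exists_commute_norm_sub_le_of_finiteDimensional A a
      (fun b hb => le_derivationNorm a hb)
    refine (eval_inf_le _ (norm_snoc_elim0_le ha) (hz1.trans ha)).trans (le_of_eq ?_)
    simpa [CStarFormula.eval, CStarTerm.eval, eval_innerDerivation, Fin.snoc,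
      derivationNorm_eq_zero_iff.2 hz, ← sub_eq_add_neg] using hza
  · refine le_trans ?_ (le_eval_sup _ (fun i => i.elim0) (x := 0) (by simp))
    refine le_eval_inf _ fun z hz => ?_
    simpa [CStarFormula.eval, CStarTerm.eval, eval_innerDerivation, Fin.snoc] using
      add_nonneg (le_max_right _ _) (derivationNorm_nonneg z)

variable {A} in
theorem exists_derivationNorm_le_of_value_centerDefect (h : centerDefect.value A = 0) {a : A}
    (ha : ‖a‖ ≤ 1) {ε : ℝ} (hε : 0 < ε) :
    ∃ z : A, ‖z‖ ≤ 1 ∧ ‖a - z‖ ≤ derivationNorm a + ε ∧ derivationNorm z ≤ ε := by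
  obtain ⟨z, hz1, hz⟩ := exists_eval_lt_of_eval_inf_lt _
    (((le_eval_sup _ (fun i => i.elim0) ha).trans_eq h).trans_lt hε)
  have hz : max (‖a - z‖ - derivationNorm a) 0 + derivationNorm z < ε := by
    simpa [CStarFormula.eval, CStarTerm.eval, eval_innerDerivation, Fin.snoc,
      ← sub_eq_add_neg] using hz
  have h1 := le_max_left (‖a - z‖ - derivationNorm a) 0
  have h2 := le_max_right (‖a - z‖ - derivationNorm a) 0
  have h3 := derivationNorm_nonneg z
  exact ⟨z, hz1, by linarith, by linarith⟩

variable {A} in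
/-- If `centerDefect` vanishes, almost central elements are close to central ones. -/
theorem exists_commute_norm_sub_le_of_value_centerDefect (h : centerDefect.value A = 0) {a : A}
    (ha : ‖a‖ ≤ 1) {ε : ℝ} (hε : 0 < ε) (haε : derivationNorm a ≤ ε) :
    ∃ z : A, (∀ b, z * b = b * z) ∧ ‖a - z‖ ≤ 4 * ε := by
  -- Iterate with tolerance `ε / 2 ^ (n + 1)`: the `n`-th move is at most `2 * ε / 2 ^ n`, so the
  -- total is `4 * ε`, and the derivation norms tend to zero.
  have hstep (n : ℕ) (x : {x : A // ‖x‖ ≤ 1}) : ∃ y : {x : A // ‖x‖ ≤ 1},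
      ‖(x : A) - y‖ ≤ derivationNorm (x : A) + ε * (1 / 2) ^ (n + 1) ∧
        derivationNorm (y : A) ≤ ε * (1 / 2) ^ (n + 1) := by
    obtain ⟨z, hz, hz'⟩ := exists_derivationNorm_le_of_value_centerDefect h x.2
      (show 0 < ε * (1 / 2) ^ (n + 1) by positivity)
    exact ⟨⟨z, hz⟩, hz'⟩
  choose s hs1 hs2 using hstep
  let t : ℕ → {x : A // ‖x‖ ≤ 1} := fun n => Nat.rec ⟨a, ha⟩ s n
  let f : ℕ → A := fun n => (t n).1
  have hf (n : ℕ) : derivationNorm (f n) ≤ ε * (1 / 2) ^ n := by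
    cases n with
    | zero => simpa [f, t] using haε
    | succ n => exact hs2 n (t n)
  have hdist (n : ℕ) : dist (f n) (f (n + 1)) ≤ 2 * ε * (1 / 2) ^ n := by
    have h1 := hs1 n (t n)
    have h2 := hf n
    have h3 : ε * (1 / 2) ^ (n + 1) ≤ ε * (1 / 2) ^ n := by
      gcongr ε * ?_
      exact pow_le_pow_of_le_one (by norm_num) (by norm_num) (Nat.le_succ n)
    rw [dist_eq_norm]
    change ‖f n - s n (t n)‖ ≤ _
    linarith
  obtain ⟨z, hz⟩ := cauchySeq_tendsto_of_complete
    (cauchySeq_of_le_geometric (1 / 2) (2 * ε) (by norm_num) hdist)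
  refine ⟨z, fun b => ?_, ?_⟩
  · refine derivationNorm_eq_zero_iff.1 (le_antisymm ?_ (derivationNorm_nonneg z)) b
    have h0 : Filter.Tendsto (fun n => ε * (1 / 2 : ℝ) ^ n + 2 * ‖z - f n‖) Filter.atTop
        (nhds (ε * 0 + 2 * ‖z - z‖)) :=
      ((tendsto_pow_atTop_nhds_zero_of_lt_one (by norm_num) (by norm_num)).const_mul ε).add
        ((hz.const_sub z).norm.const_mul 2)
    refine (ge_of_tendsto h0 (Filter.Eventually.of_forall fun n => ?_)).trans (by simp)
    exact derivationNorm_le_add_of_norm_sub_le.trans (by gcongr; exact hf n)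
  · have h0 := dist_le_of_le_geometric_of_tendsto₀ (1 / 2) (2 * ε) (by norm_num) hdist hz
    rw [dist_eq_norm] at h0
    refine h0.trans_eq (by ring)

theorem value_relativize (φ : CStarSentence) :
    (relativize φ).value A =
      min |φ.value A| (centralZeroDivisor.value A) * unitBallRadius.value A := by
  simp [relativize, CStarSentence.value, CStarFormula.eval]

theorem value_unitBallRadius_of_subsingleton [Subsingleton A] : unitBallRadius.value A = 0 := by
  simp [unitBallRadius, CStarSentence.value, CStarFormula.eval, Subsingleton.elim (_ : A) 0]

theorem value_unitBallRadius_pos [Nontrivial A] : 0 < unitBallRadius.value A := by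
  obtain ⟨a, ha⟩ := exists_ne (0 : A)
  have h1 : ‖((‖a‖⁻¹ : ℝ) : ℂ) • a‖ = 1 := by simp [norm_smul, ha]
  refine zero_lt_one.trans_le (le_trans (le_of_eq ?_) (le_eval_sup _ (fun i => i.elim0) h1.le))
  simpa [CStarFormula.eval, CStarTerm.eval, Fin.snoc] using h1.symm

variable {A} in
theorem exists_of_value_centralZeroDivisor_lt {r : ℝ} (h : centralZeroDivisor.value A < r) :
    ∃ z x : A, ‖z‖ ≤ 1 ∧ ‖x‖ ≤ 1 ∧ ‖z * x‖ + |1 - ‖z‖| + |1 - ‖x‖| + derivationNorm z < r := by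
  obtain ⟨z, hz, h⟩ := exists_eval_lt_of_eval_inf_lt _ h
  obtain ⟨x, hx, h⟩ := exists_eval_lt_of_eval_inf_lt _ h
  exact ⟨z, x, hz, hx, by
    simpa [CStarFormula.eval, CStarTerm.eval, eval_innerDerivation, Fin.snoc] using h⟩

theorem value_centralZeroDivisor_nonneg : 0 ≤ centralZeroDivisor.value A := by
  refine le_eval_inf _ fun z hz => le_eval_inf _ fun x hx => ?_
  have h0 : 0 ≤ ‖z * x‖ + |1 - ‖z‖| + |1 - ‖x‖| + derivationNorm z :=
    add_nonneg (by positivity) (derivationNorm_nonneg z)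
  simpa [CStarFormula.eval, CStarTerm.eval, eval_innerDerivation, Fin.snoc] using h0

variable {A} in
theorem value_centralZeroDivisor_of_mul_eq_zero {z x : A} (hz : ∀ b, z * b = b * z)
    (hzx : z * x = 0) (hz0 : z ≠ 0) (hx0 : x ≠ 0) : centralZeroDivisor.value A = 0 := by
  wlog h1 : ‖z‖ = 1 ∧ ‖x‖ = 1 generalizing z x
  · refine this (z := ((‖z‖⁻¹ : ℝ) : ℂ) • z) (x := ((‖x‖⁻¹ : ℝ) : ℂ) • x) (fun b => ?_) ?_ ?_ ?_ ?_
    · rw [smul_mul_assoc, mul_smul_comm, hz]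
    · rw [smul_mul_smul_comm, hzx, smul_zero]
    · simp [hz0]
    · simp [hx0]
    · simp [norm_smul, hz0, hx0]
  refine le_antisymm ?_ (value_centralZeroDivisor_nonneg A)
  refine (eval_inf_le _ (fun i => i.elim0) h1.1.le).trans ((eval_inf_le _
    (norm_snoc_elim0_le h1.1.le) h1.2.le).trans (le_of_eq ?_))
  simp [CStarFormula.eval, CStarTerm.eval, eval_innerDerivation, Fin.snoc, hzx, h1.1, h1.2,
    derivationNorm_eq_zero_iff.2 hz]

variable {A} in
theorem le_of_value_centralNormDefect (h : centralNormDefect.value A = 0) {z : A}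
    (hz : ∀ b, z * b = b * z) (x : A) : ‖z‖ * ‖x‖ ≤ ‖z * x‖ := by
  have hball {z x : A} (hz1 : ‖z‖ ≤ 1) (hx1 : ‖x‖ ≤ 1) (hz : ∀ b, z * b = b * z) :
      ‖z‖ * ‖x‖ ≤ ‖z * x‖ := by
    have h1 := (le_eval_sup _ (norm_snoc_elim0_le hz1) hx1).trans
      ((le_eval_sup _ (fun i => i.elim0) hz1).trans_eq h)
    have h2 : max (‖z‖ * ‖x‖ - ‖z * x‖ - 2 * derivationNorm z) 0 ≤ 0 := by
      simpa [CStarFormula.eval, CStarTerm.eval, eval_innerDerivation, Fin.snoc] using h1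
    have h3 := (le_max_left _ _).trans h2
    rw [derivationNorm_eq_zero_iff.2 hz] at h3
    linarith
  refine CStarAlgebra.forall_of_forall_norm_le_one (P := fun z => (∀ b, z * b = b * z) →
    ‖z‖ * ‖x‖ ≤ ‖z * x‖) (fun z hz1 => ?_) (fun c z hP hcz => ?_) z hz
  · refine CStarAlgebra.forall_of_forall_norm_le_one (P := fun x => (∀ b, z * b = b * z) →
      ‖z‖ * ‖x‖ ≤ ‖z * x‖) (fun x hx1 => hball hz1 hx1) (fun c x hP hz => ?_) x
    rw [mul_smul_comm, norm_smul, norm_smul, mul_left_comm]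
    exact mul_le_mul_of_nonneg_left (hP hz) (norm_nonneg c)
  · by_cases hc : c = 0
    · simp [hc]
    rw [smul_mul_assoc, norm_smul, norm_smul, mul_assoc]
    refine mul_le_mul_of_nonneg_left (hP fun b => ?_) (norm_nonneg c)
    have := hcz b
    rw [smul_mul_assoc, mul_smul_comm] at this
    exact smul_right_injective A hc this

end Values

/-! ### Sentences in matrix and finite-dimensional algebras. -/

section MatrixAlgebra

open CStarFormula CStarSentence
open scoped Matrix.Norms.L2Operator

theorem Matrix.eq_smul_one_of_forall_commute {n : ℕ} {z : Matrix (Fin n) (Fin n) ℂ}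
    (hz : ∀ b, z * b = b * z) : ∃ c : ℂ, z = c • 1 := by
  obtain ⟨c, hc⟩ := Matrix.mem_range_scalar_of_commute_single (M := z)
    fun i j _ => (hz _).symm
  exact ⟨c, by rw [← hc, Matrix.scalar_apply, Matrix.smul_one_eq_diagonal]⟩

/-- Averaging puts a scalar within `derivationNorm z` of `z`, and for scalars equality holds.
Passing to the scalar and back costs one `derivationNorm z * ‖x‖` each, hence the factor 2. -/
theorem Matrix.norm_mul_norm_le_add_derivationNorm {n : ℕ} (z x : Matrix (Fin n) (Fin n) ℂ) :
    ‖z‖ * ‖x‖ ≤ ‖z * x‖ + 2 * derivationNorm z * ‖x‖ := by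
  obtain ⟨y, -, hy, hzy⟩ := NonUnitalCStarAlgebra.exists_commute_norm_sub_le_of_finiteDimensional _
    z fun b hb => le_derivationNorm z hb
  obtain ⟨c, rfl⟩ := Matrix.eq_smul_one_of_forall_commute hy
  have h1 : ‖(1 : Matrix (Fin n) (Fin n) ℂ)‖ ≤ 1 := by
    nontriviality Matrix (Fin n) (Fin n) ℂ
    exact CStarRing.norm_one.le
  have hz : ‖z‖ ≤ derivationNorm z + ‖c‖ := by
    calc ‖z‖ = ‖(z - c • 1) + c • 1‖ := by rw [sub_add_cancel]
      _ ≤ derivationNorm z + ‖c‖ := norm_add_le_of_le hzy (by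
        rw [norm_smul]; exact mul_le_of_le_one_right (norm_nonneg c) h1)
  have hx : ‖c‖ * ‖x‖ ≤ ‖z * x‖ + derivationNorm z * ‖x‖ := by
    calc ‖c‖ * ‖x‖ = ‖z * x - (z - c • 1) * x‖ := by
          rw [sub_mul, sub_sub_cancel, smul_one_mul, norm_smul]
      _ ≤ _ := norm_sub_le_of_le le_rfl (norm_mul_le_of_le hzy le_rfl)
  have := mul_le_mul_of_nonneg_right hz (norm_nonneg x)
  linarith

theorem value_centralNormDefect_matrix (n : ℕ) :
    centralNormDefect.value (Matrix (Fin n) (Fin n) ℂ) = 0 := by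
  have heval (z x : Matrix (Fin n) (Fin n) ℂ) (hx : ‖x‖ ≤ 1) :
      max (‖z‖ * ‖x‖ - ‖z * x‖ - 2 * derivationNorm z) 0 = 0 := by
    have h1 := Matrix.norm_mul_norm_le_add_derivationNorm z x
    have h2 := mul_le_mul_of_nonneg_left hx (derivationNorm_nonneg z)
    exact max_eq_right (by linarith)
  refine le_antisymm ?_ ?_
  · refine eval_sup_le _ fun z hz => eval_sup_le _ fun x hx => le_of_eq ?_
    simpa [CStarFormula.eval, CStarTerm.eval, eval_innerDerivation, Fin.snoc] using heval z x hx
  · refine le_trans ?_ (le_eval_sup _ (fun i => i.elim0) (x := 0) (by simp))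
    refine le_trans ?_ (le_eval_sup _ (norm_snoc_elim0_le (by simp)) (x := 0) (by simp))
    simp [CStarFormula.eval]

/-- A sentence that vanishes in all matrix algebras has a relativization that vanishes in all
finite-dimensional C*-algebras. -/
theorem value_relativize_of_finiteDimensional {φ : CStarSentence}
    (hφ : ∀ n : ℕ, 0 < n → φ.value (Matrix (Fin n) (Fin n) ℂ) = 0) (F : Type*)
    [NonUnitalCStarAlgebra F] [FiniteDimensional ℂ F] : (relativize φ).value F = 0 := by
  rw [value_relativize]
  -- One ingredient vanishes in each case: `unitBallRadius` for the zero algebra, `φ` for a matrix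
  -- algebra, `centralZeroDivisor` otherwise.
  by_cases hF : ∀ z x : F, (∀ b, z * b = b * z) → z * x = 0 → z = 0 ∨ x = 0
  · rcases subsingleton_or_nontrivial F with hsub | hnon
    · rw [value_unitBallRadius_of_subsingleton, mul_zero]
    · obtain ⟨n, hn, f, hf⟩ :=
        NonUnitalCStarAlgebra.exists_bijective_matrix_of_finiteDimensional F hF
      rw [← φ.value_eq_of_bijective f hf, hφ n hn, abs_zero,
        min_eq_left (value_centralZeroDivisor_nonneg F), zero_mul]
  · push Not at hF
    obtain ⟨z, x, hz, hzx, hz0, hx0⟩ := hF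
    rw [value_centralZeroDivisor_of_mul_eq_zero hz hzx hz0 hx0, min_eq_right (abs_nonneg _),
      zero_mul]

end MatrixAlgebra

/-! ### Trivial centers and the main theorem. -/

section Main

open CStarFormula CStarSentence

variable {A : Type*} [NonUnitalCStarAlgebra A]

theorem mem_center_iff_forall_commute {z : A} : z ∈ Set.center A ↔ ∀ b, z * b = b * z := by
  rw [Semigroup.mem_center_iff]
  exact forall_congr' fun b => eq_comm

theorem smul_identity_mem_center {e : A} (he : ∀ a : A, e * a = a ∧ a * e = a) (c : ℂ) :
    c • e ∈ Set.center A :=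
  mem_center_iff_forall_commute.2 fun b => by
    rw [smul_mul_assoc, mul_smul_comm, (he b).1, (he b).2]

/-- By the Gelfand-Mazur theorem, the center is trivial if its norm is multiplicative. -/
theorem center_eq_range_smul_of_norm_mul [Nontrivial A] {e : A}
    (he : ∀ a : A, e * a = a ∧ a * e = a)
    (h : ∀ z x : A, (∀ b, z * b = b * z) → ‖z‖ * ‖x‖ ≤ ‖z * x‖) :
    Set.center A = Set.range fun c : ℂ => c • e := by
  refine Set.Subset.antisymm (fun z hz => ?_) (by
    rintro _ ⟨c, rfl⟩
    exact smul_identity_mem_center he c)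
  let _ := CStarAlgebra.ofIdentity A e he
  have : NormMulClass (Subalgebra.center ℂ A) := ⟨fun x y => le_antisymm (norm_mul_le _ _)
    (h x y (mem_center_iff_forall_commute.1 x.2))⟩
  have : NormOneClass (Subalgebra.center ℂ A) := ⟨CStarRing.norm_one (E := A)⟩
  obtain ⟨f⟩ := NormedAlgebra.Complex.nonempty_algEquiv (Subalgebra.center ℂ A)
  obtain ⟨c, hc⟩ := f.surjective ⟨z, hz⟩
  refine ⟨c, ?_⟩
  have h1 : f c = algebraMap ℂ _ c := f.commutes c
  rw [hc] at h1
  exact (congrArg Subtype.val h1).symm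

/-- With trivial center, there are no almost central zero divisors. -/
theorem value_centralZeroDivisor_pos {e : A} (he1 : ‖e‖ ≤ 1)
    (hcenter : ∀ z : A, (∀ b, z * b = b * z) → ∃ c : ℂ, z = c • e)
    (he : ∀ a : A, e * a = a ∧ a * e = a) (h : centerDefect.value A = 0) :
    0 < centralZeroDivisor.value A := by
  by_contra! hle
  obtain ⟨z, x, hz, hx, hlt⟩ := exists_of_value_centralZeroDivisor_lt
    (hle.trans_lt (show (0 : ℝ) < 1 / 100 by norm_num))
  have h0 := derivationNorm_nonneg z
  have h1 := norm_nonneg (z * x)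
  have h2 := le_abs_self (1 - ‖z‖)
  have h3 := le_abs_self (1 - ‖x‖)
  have h2' := abs_nonneg (1 - ‖z‖)
  have h3' := abs_nonneg (1 - ‖x‖)
  obtain ⟨y, hy, hzy⟩ := exists_commute_norm_sub_le_of_value_centerDefect h hz
    (show (0 : ℝ) < 1 / 100 by norm_num) (by linarith)
  obtain ⟨c, rfl⟩ := hcenter y hy
  have h4 : ‖z‖ ≤ 4 * (1 / 100) + ‖c‖ := by
    calc ‖z‖ = ‖(z - c • e) + c • e‖ := by rw [sub_add_cancel]
      _ ≤ _ := norm_add_le_of_le hzy (by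
        rw [norm_smul]; exact mul_le_of_le_one_right (norm_nonneg c) he1)
  have h5 : ‖c‖ * ‖x‖ ≤ ‖z * x‖ + 4 * (1 / 100) * 1 := by
    calc ‖c‖ * ‖x‖ = ‖z * x - (z - c • e) * x‖ := by
          rw [sub_mul, sub_sub_cancel, smul_mul_assoc, (he x).1, norm_smul]
      _ ≤ _ := norm_sub_le_of_le le_rfl (norm_mul_le_of_le hzy hx)
  -- Both `‖z‖` and `‖x‖` exceed 0.99, so `‖c‖` exceeds 0.95, while `‖c‖ * ‖x‖` is below 0.05.
  nlinarith [norm_nonneg c, norm_nonneg x]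

end Main

theorem proposition6p1 (A : Type*) [NonUnitalCStarAlgebra A] [Nontrivial A]
    (hA : IsPseudocompact A) :
    ∃ e : A, (∀ a : A, e * a = a ∧ a * e = a) ∧
      (IsPseudomatricial A ↔ Set.center A = Set.range fun c : ℂ => c • e) := by
  obtain ⟨e, he1, he⟩ := exists_identity_of_value_identityDefect A
    (hA _ fun F _ _ => value_identityDefect_of_finiteDimensional F)
  refine ⟨e, he, fun h => ?_, fun h φ hφ => ?_⟩
  · exact center_eq_range_smul_of_norm_mul he fun z x hz =>
      le_of_value_centralNormDefect (h _ fun n _ => value_centralNormDefect_matrix n) hz x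
  · have hpos := value_centralZeroDivisor_pos he1 (fun z hz => by
      obtain ⟨c, hc⟩ := h ▸ mem_center_iff_forall_commute.2 hz
      exact ⟨c, hc.symm⟩) he (hA _ fun F _ _ => value_centerDefect_of_finiteDimensional F)
    have hrel := hA _ fun F _ _ => value_relativize_of_finiteDimensional hφ F
    rw [value_relativize] at hrel
    -- Nontriviality of `A` enters here: the radius factor is nonzero, so the minimum itself
    -- vanishes.
    have hmin := (mul_eq_zero.1 hrel).resolve_right (value_unitBallRadius_pos A).ne'
    by_contra hne
    exact (lt_min (abs_pos.2 hne) hpos).ne' hmin
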